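/- Let $\mathcal H$ be a complex Hilbert space, let $\mathcal K=\mathcal K(\mathcal H)$ be the $C^*$-algebra of all compact operators on $\mathcal H$, and let $E$ be a (left) Hilbert $\mathcal K$-module, with $\mathcal K$-valued inner product $\langle\cdot,\cdot\rangle$ that is $\mathcal K$-linear in the first variable. Let $B(E)$ be the $C^*$-algebra of adjointable operators on $E$, i.e. of all maps $T:E\to E$ for which there is $T^*:E\to E$ with $\langle Tx,y\rangle=\langle x,T^*y\rangle$ for all $x,y\in E$, and let $K(E)$ be the norm closure of the linear span of the operators $\Theta_{x,y}:z\mapsto\langle z,x\rangle y$, $x,y\in E$. An operator $T\in B(E)$ is called Fredholm if there are $S_1,S_2\in B(E)$ with $S_1T-1\in K(E)$ and $TS_2-1\in K(E)$. A minimal projection of $\mathcal K$ is a nonzero projection $e$ with $e\mathcal Ke=\mathbb Ce$. An orthonormal basis of a closed submodule $X\subseteq E$ is a family $(x_\lambda)$ in $X$ such that every $\langle x_\lambda,x_\lambda\rangle$ is a minimal projection of $\mathcal K$, $\langle x_\lambda,x_\mu\rangle=0$ for $\lambda\ne\mu$, and the submodule generated by $(x_\lambda)$ is dense in $X$; the orthonormal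 dimension $\dim_{\mathcal K}X$ is the common cardinality of all orthonormal bases of $X$. Theorem. Let $T\in B(E)$. Then $T$ is Fredholm if and only if the range $\operatorname{Ran}T$ is closed in $E$ and both $\dim_{\mathcal K}\operatorname{Ker}T$ and $\dim_{\mathcal K}\operatorname{Ker}T^*$ are finite. -/

import Mathlib

open scoped InnerProductSpace

/-! ### The C⋆-algebra of compact operators on a Hilbert space -/

section CompactAlgebra

variable (H : Type*) [NormedAddCommGroup H] [InnerProductSpace ℂ H] [CompleteSpace H]

variable {H} in
/-- The Hilbert space adjoint of a compact operator is compact. -/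
theorem isCompactOperator_star {T : H →L[ℂ] H} (hT : IsCompactOperator T) :
    IsCompactOperator (star T : H →L[ℂ] H) := by
  have hS : IsCompactOperator (T * star T : H →L[ℂ] H) := hT.comp_clm (star T)
  have hSt : TotallyBounded ((T * star T : H →L[ℂ] H) '' Metric.closedBall 0 1) :=
    (hS.isCompact_closure_image_closedBall
      (f := ((T * star T : H →L[ℂ] H) : H →ₗ[ℂ] H)) 1).totallyBounded.subset subset_closure
  have key : TotallyBounded ((star T : H →L[ℂ] H) '' Metric.closedBall 0 1) := by
    rw [Metric.totallyBounded_iff]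
    intro ε hε
    obtain ⟨t, hts, htf, htc⟩ :=
      Metric.finite_approx_of_totallyBounded hSt (ε ^ 2 / 2) (by positivity)
    obtain ⟨u, huB, huf, rfl⟩ := (Set.exists_subset_image_finite_and
      (p := fun s => s = t)).1 ⟨t, hts, htf, rfl⟩
    refine ⟨(star T : H →L[ℂ] H) '' u, huf.image _, ?_⟩
    rintro _ ⟨x, hx, rfl⟩
    have h1 := htc ⟨x, hx, rfl⟩
    simp only [Set.mem_iUnion, Metric.mem_ball, exists_prop, Set.mem_image,
      exists_exists_and_eq_and] at h1 ⊢
    obtain ⟨y, hy, hxy⟩ := h1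
    refine ⟨y, hy, ?_⟩
    have hyB := huB hy
    rw [mem_closedBall_zero_iff] at hx hyB
    rw [dist_eq_norm, ← map_sub] at hxy ⊢
    have h2 : ‖x - y‖ ≤ 2 := (norm_sub_le _ _).trans (by linarith)
    have h3 : ‖(star T : H →L[ℂ] H) (x - y)‖ ^ 2 ≤
        ‖(T * star T : H →L[ℂ] H) (x - y)‖ * ‖x - y‖ := by
      have h4 : (‖(star T : H →L[ℂ] H) (x - y)‖ ^ 2 : ℝ) =
          RCLike.re ⟪(T * star T : H →L[ℂ] H) (x - y), x - y⟫_ℂ := by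
        rw [← inner_self_eq_norm_sq (𝕜 := ℂ)]
        congr 1
        rw [ContinuousLinearMap.star_eq_adjoint, ContinuousLinearMap.adjoint_inner_right]
        rfl
      rw [h4]
      exact (RCLike.re_le_norm _).trans (norm_inner_le_norm _ _)
    refine lt_of_pow_lt_pow_left₀ 2 hε.le (h3.trans_lt ?_)
    nlinarith [norm_nonneg ((T * star T : H →L[ℂ] H) (x - y)), norm_nonneg (x - y)]
  refine (isCompactOperator_iff_isCompact_closure_image_closedBall
    ((star T : H →L[ℂ] H) : H →ₗ[ℂ] H) one_pos).2 ?_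
  exact key.closure.isCompact_of_isClosed isClosed_closure

/-- `𝒦(H)`: the compact operators on the Hilbert space `H`, as a (non-unital) star subalgebra of
the bounded operators. Norm, star and (Loewner) order are those of `H →L[ℂ] H`. -/
def compactAlgebra : NonUnitalStarSubalgebra ℂ (H →L[ℂ] H) where
  carrier := {T | IsCompactOperator T}
  add_mem' hS hT := hS.add hT
  zero_mem' := isCompactOperator_zero
  smul_mem' c _ hT := hT.smul c
  mul_mem' {_ T} hS _ := hS.comp_clm T
  star_mem' hT := isCompactOperator_star hT

instance compactAlgebra.isClosed : IsClosed (compactAlgebra H : Set (H →L[ℂ] H)) :=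
  isClosed_setOfPred_isCompactOperator

/-- An element of `𝒦(H)` is positive as an operator iff it is positive in the C⋆-algebra
`𝒦(H)`. -/
instance compactAlgebra.instStarOrderedRing : StarOrderedRing (compactAlgebra H) := by
  refine StarOrderedRing.of_nonneg_iff' (fun {x y} h z => ?_) (fun x => ⟨fun h => ?_, ?_⟩)
  · exact add_le_add_right (α := H →L[ℂ] H) h z
  · have h' : (0 : H →L[ℂ] H) ≤ (x : H →L[ℂ] H) := h
    have hm : CFC.sqrt (x : H →L[ℂ] H) ∈ compactAlgebra H := by
      rw [CFC.sqrt_eq_real_sqrt _ h']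
      exact NonUnitalStarAlgebra.elemental.le_of_mem (R := ℝ)
        (s := { compactAlgebra H with
          smul_mem' := fun c y hy => by
            rw [← Complex.coe_smul]
            exact (compactAlgebra H).smul_mem (c : ℂ) hy }) (compactAlgebra.isClosed H) x.2
        (cfcₙ_mem_elemental _ _)
    refine ⟨⟨_, hm⟩, Subtype.ext ?_⟩
    change (x : H →L[ℂ] H) = star (CFC.sqrt (x : H →L[ℂ] H)) * CFC.sqrt (x : H →L[ℂ] H)
    rw [(CFC.sqrt_nonneg (x : H →L[ℂ] H)).isSelfAdjoint.star_eq, CFC.sqrt_mul_sqrt_self _ h']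
  · rintro ⟨s, rfl⟩
    exact star_mul_self_nonneg (s : H →L[ℂ] H)

end CompactAlgebra

/-! ### Operators on Hilbert C⋆-modules

Mathlib's `CStarModule A E` is a left `A`-module with an `A`-valued inner product that is
`A`-linear in the *second* variable, so `inner A x y` is `⟨y, x⟩` in the convention where the inner
product is linear in the first variable. -/

section Module

variable (A E : Type*) [NonUnitalCStarAlgebra A] [PartialOrder A]
  [NormedAddCommGroup E] [NormedSpace ℂ E] [SMul A E] [CStarModule A E]

/-- `B(E)`: maps `T : E → E` that have an adjoint. -/
structure AdjointableOp where
  toFun : E → E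
  exists_adjoint : ∃ S : E → E, ∀ x y : E, inner A (toFun x) y = inner A x (S y)

variable {A E}

namespace AdjointableOp

instance : CoeFun (AdjointableOp A E) fun _ => E → E := ⟨toFun⟩

/-- The adjoint `T⋆`. -/
noncomputable def adjoint (T : AdjointableOp A E) : AdjointableOp A E where
  toFun := T.exists_adjoint.choose
  exists_adjoint := ⟨T, fun x y => by
    have h := congrArg star (T.exists_adjoint.choose_spec y x)
    rw [CStarModule.star_inner, CStarModule.star_inner] at h
    exact h.symm⟩

theorem inner_adjoint (T : AdjointableOp A E) (x y : E) :
    inner A (T x) y = inner A x (T.adjoint y) :=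
  T.exists_adjoint.choose_spec x y

theorem inner_ext {x y : E} (h : ∀ z : E, inner A x z = inner A y z) : x = y := by
  rw [← sub_eq_zero, ← CStarModule.inner_self (A := A), CStarModule.inner_sub_left, h, sub_self]

/-- Adjointable maps are linear. -/
noncomputable def toLinearMap (T : AdjointableOp A E) : E →ₗ[ℂ] E where
  toFun := T
  map_add' x y := inner_ext (A := A) fun z => by
    rw [CStarModule.inner_add_left, T.inner_adjoint, T.inner_adjoint, T.inner_adjoint,
      CStarModule.inner_add_left]
  map_smul' c x := inner_ext (A := A) fun z => by
    rw [RingHom.id_apply, CStarModule.inner_smul_left_complex, T.inner_adjoint, T.inner_adjoint,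
      CStarModule.inner_smul_left_complex]

variable [StarOrderedRing A]

/-- Adjointable maps are bounded linear operators. -/
noncomputable def toCLM [CompleteSpace E] (T : AdjointableOp A E) : E →L[ℂ] E where
  toLinearMap := T.toLinearMap
  cont := by
    refine T.toLinearMap.continuous_of_seq_closed_graph fun u x y hu hTu => ?_
    refine inner_ext (A := A) fun z => ?_
    have hc : ∀ w : E, Continuous fun v : E => inner A v w := fun w =>
      (CStarModule.continuous_inner (A := A) (E := E)).comp (continuous_id.prodMk continuous_const)
    refine tendsto_nhds_unique (((hc z).tendsto y).comp hTu) ?_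
    have h := ((hc (T.adjoint z)).tendsto x).comp hu
    rw [show inner A (T.toLinearMap x) z = inner A x (T.adjoint z) from T.inner_adjoint x z]
    exact h.congr fun n => (T.inner_adjoint (u n) z).symm

/-- The elementary operator `Θ_{x,y}(z) = ⟨z, x⟩ y` (inner product linear in the first variable),
with adjoint `Θ_{y,x}`. -/
def theta (x y : E) : AdjointableOp A E where
  toFun z := inner A x z • y
  exists_adjoint := ⟨fun w => inner A y w • x, fun z w => by
    rw [CStarModule.inner_op_smul_left, CStarModule.inner_op_smul_right, CStarModule.star_inner]⟩

end AdjointableOp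

variable [StarOrderedRing A]

variable (A E) in
/-- `K(E)`: the operator-norm closure of the linear span of the operators `Θ_{x,y}`. -/
noncomputable def moduleCompacts [CompleteSpace E] : Submodule ℂ (E →L[ℂ] E) :=
  (Submodule.span ℂ
    (Set.range fun p : E × E => (AdjointableOp.theta (A := A) p.1 p.2).toCLM)).topologicalClosure

/-- `T ∈ B(E)` is Fredholm: it has a left and a right inverse in `B(E)` modulo `K(E)`. -/
def AdjointableOp.IsFredholm [CompleteSpace E] (T : AdjointableOp A E) : Prop :=
  (∃ S : AdjointableOp A E, S.toCLM ∘L T.toCLM - ContinuousLinearMap.id ℂ E ∈ moduleCompacts A E) ∧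
  (∃ S : AdjointableOp A E, T.toCLM ∘L S.toCLM - ContinuousLinearMap.id ℂ E ∈ moduleCompacts A E)

/-! ### Orthonormal bases and orthonormal dimension -/

/-- A minimal projection of a C⋆-algebra: a nonzero projection `e` with `e A e = ℂ e`. -/
def IsMinimalProjection (e : A) : Prop :=
  IsStarProjection e ∧ e ≠ 0 ∧ ∀ a : A, ∃ c : ℂ, e * a * e = c • e

variable (A) in
/-- Orthonormal system: each `⟨x, x⟩` is a minimal projection and distinct members are
orthogonal. (Members are nonzero, so a system is the same as the set of its members.) -/
def IsOrthonormalSystem (S : Set E) : Prop :=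
  (∀ x ∈ S, IsMinimalProjection (inner A x x)) ∧ S.Pairwise fun x y => inner A x y = 0

variable (A) in
/-- The `A`-submodule of `E` generated by `S`. -/
def generatedSubmodule (S : Set E) : Submodule ℂ E :=
  Submodule.span ℂ (S ∪ {y | ∃ a : A, ∃ x ∈ S, y = a • x})

variable (A) in
/-- `S` is an orthonormal basis of the submodule `X`: an orthonormal system in `X` that generates a
dense submodule of `X`. -/
def IsOrthonormalBasisOf (X : Submodule ℂ E) (S : Set E) : Prop :=
  S ⊆ X ∧ IsOrthonormalSystem A S ∧ (X : Set E) ⊆ closure (generatedSubmodule A S : Set E)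

variable (A) in
/-- The orthonormal dimension of the submodule `X`: the cardinality of its orthonormal bases, with
value `⊤` when it is infinite. (All orthonormal bases have the same cardinality; were there no
basis at all, the value would be `⊤`.) -/
noncomputable def orthonormalDim (X : Submodule ℂ E) : ℕ∞ :=
  ⨅ (S : Set E) (_ : IsOrthonormalBasisOf A X S), S.encard

end Module

/-!
For a unit vector `ξ`, with `e` the projection onto `ℂ ξ`, the corner `e E` is a Hilbert space, and
`x ∈ E` is controlled by its cut-downs `(ξ ⊗ η) • x ∈ e E`. Operators in `K(E)` restrict to compact
operators on `e E`, so the compactness arguments for Fredholm operators on a Hilbert space apply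
there, and finite dimension of the kernels and the lower bound expressing closed range pass from the
corner to `E`.

Conversely, finite orthonormal bases of the kernels of `T` and `T⋆` give orthogonal projections `P`
and `Q` onto them lying in `K(E)`. If the range of `T` is closed then `T⋆T + P` is self-adjoint and
bounded below, hence invertible, and `R = (T⋆T + P)⁻¹T⋆` satisfies `R T = 1 - P` and `T R = 1 - Q`.
-/

section Banach

open Filter Topology

variable {𝕜 V F G : Type*} [RCLike 𝕜] [NormedAddCommGroup V] [NormedSpace 𝕜 V]
  [NormedAddCommGroup F] [NormedSpace 𝕜 F] [NormedAddCommGroup G] [NormedSpace 𝕜 G]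

theorem isClosed_range_iff_exists_norm_sub_le [CompleteSpace V] [CompleteSpace F]
    {f : V →L[𝕜] F} {p : V →L[𝕜] V} (hfp : ∀ x, f (p x) = 0) (hp : ∀ x, f x = 0 → p x = x) :
    IsClosed (Set.range f) ↔ ∃ C : ℝ, 0 ≤ C ∧ ∀ x, ‖x - p x‖ ≤ C * ‖f x‖ := by
  have : CompleteSpace p.ker := p.isClosed_ker.completeSpace_coe
  have hsub : ∀ x, x - p x ∈ p.ker := fun x => by
    rw [LinearMap.mem_ker, ContinuousLinearMap.coe_coe, map_sub, hp _ (hfp x), sub_self]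
  have hfsub : ∀ x, f (x - p x) = f x := fun x => by rw [map_sub, hfp, sub_zero]
  have hrange : Set.range (f ∘L p.ker.subtypeL) = Set.range f :=
    Set.Subset.antisymm (Set.range_subset_iff.2 fun x => ⟨x, rfl⟩)
      (Set.range_subset_iff.2 fun x => ⟨⟨_, hsub x⟩, hfsub x⟩)
  have hinj : Function.Injective (f ∘L p.ker.subtypeL) :=
    (injective_iff_map_eq_zero _).2 fun x hx => Subtype.ext ((hp _ hx).symm.trans x.2)
  rw [← hrange, ContinuousLinearMap.isClosed_range_iff_antilipschitz_of_injective _ hinj]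
  constructor
  · rintro ⟨K, hK⟩
    refine ⟨K, K.2, fun x => ?_⟩
    calc ‖x - p x‖ ≤ K * ‖f (x - p x)‖ := hK.le_mul_norm (map_zero _) ⟨_, hsub x⟩
      _ = K * ‖f x‖ := by rw [hfsub]
  · rintro ⟨C, hC, h⟩
    refine ⟨⟨C, hC⟩, ContinuousLinearMap.antilipschitz_of_bound _ fun x => ?_⟩
    have hx := h x
    rwa [show p x = 0 from x.2, sub_zero] at hx

theorem exists_tendsto_subseq_of_norm_le_add_compact [CompleteSpace V] {f : V →L[𝕜] F}
    {k : V →L[𝕜] G} (hk : IsCompactOperator k) {C : ℝ} (h : ∀ x, ‖x‖ ≤ C * ‖f x‖ + ‖k x‖)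
    {x : ℕ → V} {R : ℝ} (hx : ∀ n, ‖x n‖ ≤ R) {y : F} (hfx : Tendsto (f ∘ x) atTop (𝓝 y)) :
    ∃ v, ∃ φ : ℕ → ℕ, StrictMono φ ∧ Tendsto (x ∘ φ) atTop (𝓝 v) := by
  have hanti : AntilipschitzWith (‖C‖₊ + 1) (f.prod k) :=
    ContinuousLinearMap.antilipschitz_of_bound _ fun x => by
      calc ‖x‖ ≤ C * ‖f x‖ + ‖k x‖ := h x
        _ ≤ ‖C‖ * ‖f.prod k x‖ + ‖f.prod k x‖ := by
          gcongr
          · exact Real.le_norm_self C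
          · exact le_max_left _ _
          · exact le_max_right _ _
        _ = _ := by push_cast; ring
  obtain ⟨K, hK, hkK⟩ := hk.image_closedBall_subset_compact (f := (k : V →ₗ[𝕜] G)) R
  obtain ⟨z, -, φ, hφ, hz⟩ := hK.tendsto_subseq fun n =>
    hkK ⟨x n, mem_closedBall_zero_iff.2 (hx n), rfl⟩
  have hemb := hanti.isClosedEmbedding (f.prod k).uniformContinuous
  have hlim : Tendsto (f.prod k ∘ x ∘ φ) atTop (𝓝 (y, z)) :=
    (hfx.comp hφ.tendsto_atTop).prodMk_nhds hz
  obtain ⟨v, hv⟩ := hemb.isClosed_range.mem_of_tendsto hlim (.of_forall fun n => ⟨_, rfl⟩)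
  exact ⟨v, φ, hφ, hemb.isInducing.tendsto_nhds_iff.2 (hv ▸ hlim)⟩

theorem exists_norm_le_of_norm_le_add_compact [CompleteSpace V] {f : V →L[𝕜] F} {k : V →L[𝕜] G}
    (hf : Function.Injective f) (hk : IsCompactOperator k) {C : ℝ}
    (h : ∀ x, ‖x‖ ≤ C * ‖f x‖ + ‖k x‖) : ∃ C' : ℝ, 0 ≤ C' ∧ ∀ x, ‖x‖ ≤ C' * ‖f x‖ := by
  suffices ∃ n : ℕ, ∀ x, ‖x‖ ≤ (n + 1) * ‖f x‖ from
    let ⟨n, hn⟩ := this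
    ⟨n + 1, by positivity, hn⟩
  by_contra! hlt
  choose x hx using hlt
  have hx0 : ∀ n, ‖x n‖ ≠ 0 := fun n => ((by positivity : (0 : ℝ) ≤ _).trans_lt (hx n)).ne'
  let u : ℕ → V := fun n => ((‖x n‖ : 𝕜)⁻¹) • x n
  have hu : ∀ n, ‖u n‖ = 1 := fun n => by simp [u, norm_smul, hx0 n]
  have hfu : Tendsto (f ∘ u) atTop (𝓝 0) := by
    refine squeeze_zero_norm (fun n => ?_) tendsto_one_div_add_atTop_nhds_zero_nat
    have hpos : 0 < ‖x n‖ := (norm_nonneg _).lt_of_ne' (hx0 n)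
    rw [Function.comp_apply, map_smul, norm_smul, norm_inv, RCLike.norm_ofReal, abs_norm,
      inv_mul_le_iff₀ hpos, mul_one_div, le_div_iff₀ (by positivity), mul_comm]
    exact (hx n).le
  obtain ⟨v, φ, hφ, hv⟩ :=
    exists_tendsto_subseq_of_norm_le_add_compact hk h (fun n => (hu n).le) hfu
  have hv1 : ‖v‖ = 1 := tendsto_nhds_unique hv.norm (by simp [hu])
  have hfv : f v = 0 := tendsto_nhds_unique ((f.continuous.tendsto v).comp hv)
    (hfu.comp hφ.tendsto_atTop)
  rw [(map_eq_zero_iff f hf).1 hfv, norm_zero] at hv1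
  exact zero_ne_one hv1

theorem finiteDimensional_of_norm_le_compact [CompleteSpace V] {k : V →L[𝕜] G}
    (hk : IsCompactOperator k) (h : ∀ x, ‖x‖ ≤ ‖k x‖) : FiniteDimensional 𝕜 V := by
  refine FiniteDimensional.of_isCompact_closedBall 𝕜 one_pos (c := 0) ?_
  refine isCompact_iff_isSeqCompact.2 fun x hx => ?_
  obtain ⟨v, φ, hφ, hv⟩ := exists_tendsto_subseq_of_norm_le_add_compact (f := (0 : V →L[𝕜] G)) hk
    (C := 0) (fun x => by simpa using h x) (fun n => mem_closedBall_zero_iff.1 (hx n))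
    tendsto_const_nhds
  exact ⟨v, Metric.isClosed_closedBall.mem_of_tendsto hv (.of_forall fun n => hx _), φ, hφ, hv⟩

theorem isCompactOperator_of_forall_mem {W : Submodule 𝕜 F} [FiniteDimensional 𝕜 W]
    (f : V →L[𝕜] F) (hf : ∀ x, f x ∈ W) : IsCompactOperator f :=
  have := FiniteDimensional.proper_rclike 𝕜 W
  (isCompactOperator_of_locallyCompactSpace_dom (f.codRestrict W hf)).clm_comp W.subtypeL

variable [CompleteSpace V]

theorem isUnit_of_norm_le_of_norm_sub_lt {B u : V →L[𝕜] V} (hu : IsUnit u) {c : ℝ}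
    (hc : ∀ x, ‖x‖ ≤ c * ‖u x‖) (h : ‖B - u‖ < c⁻¹) : IsUnit B := by
  cases subsingleton_or_nontrivial V
  · rwa [Subsingleton.elim B u]
  obtain ⟨u, rfl⟩ := hu
  have hc0 : 0 < c := inv_pos.1 ((norm_nonneg _).trans_lt h)
  have hinv : ‖(↑u⁻¹ : V →L[𝕜] V)‖ ≤ c :=
    ContinuousLinearMap.opNorm_le_bound _ hc0.le fun x => by
      simpa [← mul_apply_eq_comp] using hc ((↑u⁻¹ : V →L[𝕜] V) x)
  exact (u.ofNearby B (h.trans_le (inv_anti₀ (Units.norm_pos _) hinv))).isUnit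

/-- Method of continuity. -/
theorem isUnit_of_norm_le_of_preconnectedSpace {ι : Type*} [TopologicalSpace ι]
    [PreconnectedSpace ι] {B : ι → V →L[𝕜] V} (hB : Continuous B) {c : ℝ} (hc0 : 0 < c)
    (hc : ∀ t x, ‖x‖ ≤ c * ‖B t x‖) {t₀ : ι} (ht₀ : IsUnit (B t₀)) (t : ι) : IsUnit (B t) := by
  have hclosed : IsClosed {t | IsUnit (B t)} := isClosed_of_closure_subset fun s hs => by
    have hnear : {r | ‖B s - B r‖ < c⁻¹} ∈ 𝓝 s :=
      (isOpen_lt (by fun_prop) continuous_const).mem_nhds (by simpa using hc0)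
    obtain ⟨r, hsr, hr⟩ := mem_closure_iff_nhds.1 hs _ hnear
    exact isUnit_of_norm_le_of_norm_sub_lt hr (hc r) hsr
  have hclopen : IsClopen {t | IsUnit (B t)} := ⟨hclosed, Units.isOpen.preimage hB⟩
  exact Set.eq_univ_iff_forall.1 (hclopen.eq_univ ⟨t₀, ht₀⟩) t

end Banach

section HilbertModule

variable {A E : Type*} [NonUnitalCStarAlgebra A] [PartialOrder A]
  [NormedAddCommGroup E] [NormedSpace ℂ E] [SMul A E] [CStarModule A E]

variable (A) in
theorem ext_inner_left_cstar {x y : E} (h : ∀ z : E, inner A z x = inner A z y) : x = y :=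
  AdjointableOp.inner_ext (A := A) fun z => by
    rw [← CStarModule.star_inner z x, ← CStarModule.star_inner z y, h]

theorem mul_smul_cstar (a b : A) (x : E) : (a * b) • x = a • b • x :=
  ext_inner_left_cstar A fun z => by simp only [CStarModule.inner_op_smul_right, mul_assoc]

theorem norm_smul_le_cstar (a : A) (x : E) : ‖a • x‖ ≤ ‖a‖ * ‖x‖ := by
  refine le_of_sq_le_sq ?_ (by positivity)
  rw [CStarModule.norm_sq_eq A, CStarModule.inner_op_smul_left, CStarModule.inner_op_smul_right,
    mul_pow, CStarModule.norm_sq_eq A (x := x)]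
  calc ‖a * inner A x x * star a‖ ≤ ‖a‖ * ‖inner A x x‖ * ‖star a‖ :=
        (norm_mul_le _ _).trans (by gcongr; exact norm_mul_le _ _)
    _ = ‖a‖ ^ 2 * ‖inner A x x‖ := by rw [norm_star]; ring

variable (A E) in
/-- The action of `A` on a Hilbert `A`-module, as a bounded bilinear map. -/
noncomputable def moduleSMulL : A →L[ℂ] E →L[ℂ] E :=
  (LinearMap.mk₂ ℂ (fun (a : A) (x : E) => a • x)
    (fun a b x => ext_inner_left_cstar A fun z => by simp [add_mul])
    (fun c a x => ext_inner_left_cstar A fun z => by simp [smul_mul_assoc])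
    (fun a x y => ext_inner_left_cstar A fun z => by simp [mul_add])
    (fun c a x => ext_inner_left_cstar A fun z => by simp [mul_smul_comm])).mkContinuous₂ 1
    fun a x => by simpa using norm_smul_le_cstar a x

@[simp]
theorem moduleSMulL_apply (a : A) (x : E) : moduleSMulL A E a x = a • x := rfl

theorem norm_sub_smul_sq_le {f : A} (hf : IsSelfAdjoint f) (hf1 : ‖f‖ ≤ 1) (x : E) :
    ‖x - f • x‖ ^ 2 ≤ 2 * ‖inner A x x - f * inner A x x‖ := by
  set a := inner A x x with ha
  have hinner : inner A (x - f • x) (x - f • x) = (a - f * a) - (a - f * a) * f := by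
    simp only [CStarModule.inner_sub_left, CStarModule.inner_sub_right,
      CStarModule.inner_op_smul_left, CStarModule.inner_op_smul_right, hf.star_eq, ← ha, sub_mul,
      mul_sub, mul_assoc]
    abel
  calc ‖x - f • x‖ ^ 2 = ‖(a - f * a) - (a - f * a) * f‖ := by
        rw [CStarModule.norm_sq_eq A, hinner]
    _ ≤ ‖a - f * a‖ + ‖a - f * a‖ * ‖f‖ :=
        (norm_sub_le _ _).trans (by gcongr; exact norm_mul_le _ _)
    _ ≤ ‖a - f * a‖ + ‖a - f * a‖ * 1 := by gcongr
    _ = 2 * ‖a - f * a‖ := by ring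

variable (A) in
/-- `G` is an adjoint of `F` for the `A`-valued inner product. -/
def IsAdjointPair (F G : E → E) : Prop :=
  ∀ x y, inner A (F x) y = inner A x (G y)

namespace IsAdjointPair

variable {F G F' G' P : E → E}

theorem symm (h : IsAdjointPair A F G) : IsAdjointPair A G F := fun x y => by
  rw [← CStarModule.star_inner, ← h, CStarModule.star_inner]

theorem comp (h : IsAdjointPair A F G) (h' : IsAdjointPair A F' G') :
    IsAdjointPair A (F ∘ F') (G' ∘ G) := fun _ _ => (h _ _).trans (h' _ _)

theorem add (h : IsAdjointPair A F G) (h' : IsAdjointPair A F' G') :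
    IsAdjointPair A (F + F') (G + G') := fun x y => by
  simp only [Pi.add_apply, CStarModule.inner_add_left, CStarModule.inner_add_right, h x y, h' x y]

theorem of_inverse (h : IsAdjointPair A F G) (hF : Function.RightInverse F' F)
    (hG : Function.RightInverse G' G) : IsAdjointPair A F' G' := fun x y => by
  conv_lhs => rw [← hG y]
  rw [← h, hF]

theorem map_map_eq_zero (h : IsAdjointPair A F G) (hP : IsAdjointPair A P P)
    (hFP : ∀ x, F (P x) = 0) (x : E) : P (G x) = 0 :=
  ext_inner_left_cstar A fun z => by
    rw [← hP, ← h, hFP, CStarModule.inner_zero_left, CStarModule.inner_zero_right]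

end IsAdjointPair

namespace AdjointableOp

theorem isAdjointPair (T : AdjointableOp A E) : IsAdjointPair A T T.adjoint :=
  T.inner_adjoint

@[simp]
theorem map_zero (T : AdjointableOp A E) : T 0 = 0 := T.toLinearMap.map_zero

@[simp]
theorem map_sub (T : AdjointableOp A E) (x y : E) : T (x - y) = T x - T y :=
  T.toLinearMap.map_sub x y

theorem map_smul (T : AdjointableOp A E) (a : A) (x : E) : T (a • x) = a • T x :=
  inner_ext (A := A) fun z => by simp [T.inner_adjoint]

theorem smul_mem_ker (T : AdjointableOp A E) (a : A) (x : E)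
    (hx : x ∈ LinearMap.ker T.toLinearMap) : a • x ∈ LinearMap.ker T.toLinearMap :=
  calc T (a • x) = a • T x := T.map_smul a x
    _ = moduleSMulL A E a 0 := congrArg (a • ·) hx
    _ = 0 := _root_.map_zero _

end AdjointableOp

theorem inner_self_smul_of_isMinimalProjection {x : E} (hx : IsMinimalProjection (inner A x x)) :
    inner A x x • x = x := by
  rw [← sub_eq_zero, ← CStarModule.inner_self (A := A)]
  simp [hx.1.isIdempotentElem.eq]

theorem sum_inner_smul_eq_self {S : Finset E} (hS : IsOrthonormalSystem A (S : Set E)) {s : E}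
    (hs : s ∈ S) : ∑ t ∈ S, inner A t s • t = s := by
  rw [Finset.sum_eq_single s, inner_self_smul_of_isMinimalProjection (hS.1 s hs)]
  · intro t ht hts
    rw [hS.2 ht hs hts]
    exact (moduleSMulL A E).map_zero₂ t
  · exact fun h => absurd hs h

theorem smul_mem_generatedSubmodule (a : A) {S : Set E} {x : E} (hx : x ∈ Submodule.span ℂ S) :
    a • x ∈ generatedSubmodule A S := by
  have hle : Submodule.span ℂ S ≤
      (generatedSubmodule A S).comap (moduleSMulL A E a).toLinearMap :=
    Submodule.span_le.2 fun s hs => Submodule.subset_span (Or.inr ⟨a, s, hs, rfl⟩)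
  exact hle hx

theorem orthonormalDim_lt_top_of_subsingleton [Subsingleton E] (X : Submodule ℂ E) :
    orthonormalDim A X < ⊤ := by
  refine (iInf₂_le ∅ ⟨Set.empty_subset _, ⟨by simp, by simp⟩, fun x _ => ?_⟩).trans_lt (by simp)
  rw [Subsingleton.elim x 0]
  exact subset_closure (zero_mem _)

variable [StarOrderedRing A]

theorem norm_le_norm_add_of_inner_eq_zero {x y : E} (h : inner A x y = 0) : ‖x‖ ≤ ‖x + y‖ := by
  have h' : inner A y x = 0 := by rw [← CStarModule.star_inner, h, star_zero]
  refine le_of_sq_le_sq ?_ (norm_nonneg _)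
  rw [CStarModule.norm_sq_eq A, CStarModule.norm_sq_eq A, CStarModule.inner_add_left,
    CStarModule.inner_add_right, CStarModule.inner_add_right, h, h', add_zero, zero_add]
  exact CStarAlgebra.norm_le_norm_of_nonneg_of_le CStarModule.inner_self_nonneg
    (le_add_of_nonneg_right CStarModule.inner_self_nonneg)

theorem norm_map_le_of_norm_sub_le {T P : AdjointableOp A E} (hTP : ∀ x, T (P x) = 0) {C : ℝ}
    (hC : ∀ x, ‖x - P x‖ ≤ C * ‖T x‖) (x : E) : ‖T x‖ ≤ C * ‖T.adjoint (T x)‖ := by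
  rcases (norm_nonneg (T x)).eq_or_lt with h0 | h0
  · rw [norm_eq_zero.1 h0.symm, AdjointableOp.map_zero, norm_zero, mul_zero]
  have hTx : T (x - P x) = T x := by rw [T.map_sub, hTP, sub_zero]
  refine le_of_mul_le_mul_left ?_ h0
  calc ‖T x‖ * ‖T x‖ = ‖inner A (x - P x) (T.adjoint (T x))‖ := by
        rw [← T.inner_adjoint, hTx, ← sq, CStarModule.norm_sq_eq A]
    _ ≤ ‖x - P x‖ * ‖T.adjoint (T x)‖ := CStarModule.norm_inner_le E
    _ ≤ C * ‖T x‖ * ‖T.adjoint (T x)‖ := by gcongr; exact hC x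
    _ = ‖T x‖ * (C * ‖T.adjoint (T x)‖) := by ring

variable [CompleteSpace E]

@[simp]
theorem AdjointableOp.toCLM_apply (T : AdjointableOp A E) (x : E) : T.toCLM x = T x := rfl

/-- The numerical range of a self-adjoint `B` is real, so `‖B x‖ ≤ ‖B x - i t x‖` and `B` is
connected to the invertible operators `i t - B`, `|t| > ‖B‖`, within the operators bounded below. -/
theorem isUnit_of_isAdjointPair_self {B : E →L[ℂ] E} (hB : IsAdjointPair A B B) {c : ℝ}
    (hc0 : 0 < c) (hc : ∀ x, ‖x‖ ≤ c * ‖B x‖) : IsUnit B := by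
  let D : ℝ → E →L[ℂ] E := fun t => algebraMap ℂ (E →L[ℂ] E) (t * Complex.I) - B
  have hinner : ∀ t x, inner A (D t x) (D t x) = inner A (B x) (B x) + (t ^ 2) • inner A x x := by
    intro t x
    have hDx : D t x = (t * Complex.I) • x - B x := rfl
    have hstar : star (t * Complex.I) = -(t * Complex.I) := by simp
    have hsq : (t * Complex.I) * (t * Complex.I) = -((t ^ 2 : ℝ) : ℂ) := by
      rw [mul_mul_mul_comm, Complex.I_mul_I, mul_neg_one, ← sq, Complex.ofReal_pow]
    rw [hDx]
    simp only [CStarModule.inner_sub_left, CStarModule.inner_sub_right,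
      CStarModule.inner_smul_left_complex, CStarModule.inner_smul_right_complex, hB x x, hstar,
      smul_sub, smul_neg, neg_smul, smul_smul, hsq, neg_neg, Complex.coe_smul]
    abel
  have hD : ∀ t x, ‖B x‖ ≤ ‖D t x‖ := fun t x => by
    refine le_of_sq_le_sq ?_ (norm_nonneg _)
    rw [CStarModule.norm_sq_eq A, CStarModule.norm_sq_eq A, hinner]
    exact CStarAlgebra.norm_le_norm_of_nonneg_of_le CStarModule.inner_self_nonneg
      (le_add_of_nonneg_right (smul_nonneg (sq_nonneg t) CStarModule.inner_self_nonneg))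
  let s : ℝ := ‖B‖ * ‖(1 : E →L[ℂ] E)‖ + 1
  have hunit : IsUnit (D s) := spectrum.mem_resolventSet_of_norm_lt_mul (by
    rw [norm_mul, Complex.norm_I, mul_one, Complex.norm_real]
    exact (lt_add_one _).trans_le (Real.le_norm_self _))
  have hcont : Continuous D := by fun_prop
  have h0 : IsUnit (D 0) := isUnit_of_norm_le_of_preconnectedSpace hcont hc0
    (fun t x => (hc x).trans (by gcongr; exact hD t x)) hunit 0
  simpa [D] using h0

/-- The orthogonal projection of a Hilbert module onto a submodule, as a property of an adjointable
operator: a submodule of a Hilbert module need not be orthogonally complemented. -/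
structure IsOrthogonalProjectionOnto (P : AdjointableOp A E) (X : Submodule ℂ E) : Prop where
  isAdjointPair : IsAdjointPair A P P
  map_mem : ∀ x, P x ∈ X
  map_eq_self : ∀ x ∈ X, P x = x

theorem exists_norm_le_adjoint_map_add {T P : AdjointableOp A E}
    (hP : IsOrthogonalProjectionOnto P (LinearMap.ker T.toLinearMap))
    (hT : IsClosed (Set.range T)) :
    ∃ c : ℝ, 0 < c ∧ ∀ x, ‖x‖ ≤ c * ‖T.adjoint (T x) + P x‖ := by
  obtain ⟨C, hC0, hC⟩ := (isClosed_range_iff_exists_norm_sub_le (f := T.toCLM) (p := P.toCLM)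
    hP.map_mem hP.map_eq_self).1 hT
  have horth : ∀ x, inner A (T.adjoint (T x)) (P x) = 0 := fun x => by
    rw [T.isAdjointPair.symm, show T (P x) = 0 from hP.map_mem x, CStarModule.inner_zero_right]
  have horth' : ∀ x, inner A (P x) (T.adjoint (T x)) = 0 := fun x => by
    rw [← CStarModule.star_inner, horth, star_zero]
  refine ⟨C * C + 1, by positivity, fun x => ?_⟩
  calc ‖x‖ ≤ ‖x - P x‖ + ‖P x‖ := by simpa using norm_add_le (x - P x) (P x)
    _ ≤ C * ‖T x‖ + ‖P x‖ := by gcongr; exact hC x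
    _ ≤ C * (C * ‖T.adjoint (T x)‖) + ‖P x‖ := by
      gcongr; exact norm_map_le_of_norm_sub_le hP.map_mem hC x
    _ ≤ C * (C * ‖T.adjoint (T x) + P x‖) + ‖T.adjoint (T x) + P x‖ := by
      gcongr
      · exact norm_le_norm_add_of_inner_eq_zero (horth x)
      · exact add_comm (P x) _ ▸ norm_le_norm_add_of_inner_eq_zero (horth' x)
    _ = (C * C + 1) * ‖T.adjoint (T x) + P x‖ := by ring

/-- With `P` and `Q` the projections onto the kernels of `T` and `T⋆`, the operator
`(T⋆T + P)⁻¹ T⋆` is the Moore–Penrose inverse of `T`. -/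
theorem exists_map_map_eq_sub {T P Q : AdjointableOp A E}
    (hP : IsOrthogonalProjectionOnto P (LinearMap.ker T.toLinearMap))
    (hQ : IsOrthogonalProjectionOnto Q (LinearMap.ker T.adjoint.toLinearMap))
    (hT : IsClosed (Set.range T)) :
    ∃ R : AdjointableOp A E, (∀ x, R (T x) = x - P x) ∧ ∀ y, T (R y) = y - Q y := by
  have hPT := T.isAdjointPair.map_map_eq_zero hP.isAdjointPair hP.map_mem
  have hQT := T.isAdjointPair.symm.map_map_eq_zero hQ.isAdjointPair hQ.map_mem
  have hPP : ∀ x, P (P x) = P x := fun x => hP.map_eq_self _ (hP.map_mem x)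
  let B : E →L[ℂ] E := T.adjoint.toCLM ∘L T.toCLM + P.toCLM
  have hB : IsAdjointPair A B B := (T.isAdjointPair.symm.comp T.isAdjointPair).add hP.isAdjointPair
  obtain ⟨c, hc0, hc⟩ := exists_norm_le_adjoint_map_add hP hT
  obtain ⟨u, hu⟩ := isUnit_of_isAdjointPair_self hB hc0 hc
  set U : E →L[ℂ] E := ↑u⁻¹
  have hUB : ∀ x, U (B x) = x := DFunLike.congr_fun (hu ▸ u.inv_mul : U * B = 1)
  have hBU : ∀ x, B (U x) = x := DFunLike.congr_fun (hu ▸ u.mul_inv : B * U = 1)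
  have hBP : ∀ x, B (P x) = P x := fun x => by
    have hTP : T (P x) = 0 := hP.map_mem x
    simp [B, hTP, hPP]
  have hPB : ∀ x, P (B x) = P x := fun x =>
    (P.toCLM.map_add _ _).trans (by simp [hPT, hPP])
  let R : AdjointableOp A E :=
    ⟨U ∘ T.adjoint, T ∘ U, (hB.of_inverse hBU hBU).comp T.isAdjointPair.symm⟩
  refine ⟨R, fun x => ?_, fun y => ?_⟩
  · calc U (T.adjoint (T x)) = U (B x - B (P x)) := by rw [hBP]; simp [B]
      _ = x - P x := by rw [map_sub, hUB, hUB]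
  · have hPR : P (R y) = 0 := by rw [← hPB]; exact (congrArg P (hBU _)).trans (hPT y)
    have hTR : T.adjoint (T (R y)) = T.adjoint y :=
      calc T.adjoint (T (R y)) = B (R y) - P (R y) := by simp [B]
        _ = T.adjoint y := by rw [hPR, sub_zero]; exact hBU _
    have hker : T.adjoint (y - T (R y)) = 0 := by rw [AdjointableOp.map_sub, hTR, sub_self]
    have hQy : Q y = y - T (R y) := by
      simpa only [AdjointableOp.map_sub, hQT, sub_zero] using hQ.map_eq_self _ hker
    rw [hQy, sub_sub_cancel]

theorem theta_mem_moduleCompacts (x y : E) :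
    (AdjointableOp.theta (A := A) x y).toCLM ∈ moduleCompacts A E :=
  Submodule.le_topologicalClosure _ (Submodule.subset_span ⟨(x, y), rfl⟩)

theorem moduleCompacts_le {V : Submodule ℂ (E →L[ℂ] E)} (hV : IsClosed (V : Set (E →L[ℂ] E)))
    (h : ∀ x y : E, (AdjointableOp.theta (A := A) x y).toCLM ∈ V) : moduleCompacts A E ≤ V :=
  Submodule.topologicalClosure_minimal _ (Submodule.span_le.2 fun _ ⟨p, hp⟩ => hp ▸ h p.1 p.2) hV

theorem exists_isOrthogonalProjectionOnto {X : Submodule ℂ E}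
    (hX : ∀ a : A, ∀ x ∈ X, a • x ∈ X) (hd : orthonormalDim A X < ⊤) :
    ∃ P : AdjointableOp A E, IsOrthogonalProjectionOnto P X ∧ P.toCLM ∈ moduleCompacts A E := by
  simp only [orthonormalDim, iInf_lt_iff] at hd
  obtain ⟨S, ⟨hSX, hS, hdense⟩, hfin⟩ := hd
  lift S to Finset E using Set.encard_lt_top_iff.1 hfin
  have hsymm : IsAdjointPair A (fun x : E => ∑ s ∈ S, inner A s x • s)
      (fun x : E => ∑ s ∈ S, inner A s x • s) := fun x y => by simp
  let P : AdjointableOp A E := ⟨_, _, hsymm⟩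
  have hP : P.toCLM = ∑ s ∈ S, (AdjointableOp.theta (A := A) s s).toCLM := by
    ext x
    simp [P, AdjointableOp.theta]
  have hgen : generatedSubmodule A (S : Set E) ≤
      LinearMap.eqLocus P.toCLM.toLinearMap LinearMap.id := by
    have hPS : ∀ s ∈ S, P s = s := fun s hs => sum_inner_smul_eq_self hS hs
    refine Submodule.span_le.2 ?_
    rintro _ (hs | ⟨a, s, hs, rfl⟩)
    · exact hPS _ hs
    · exact (P.map_smul a s).trans (congrArg (a • ·) (hPS s hs))
  refine ⟨P, ⟨hsymm, fun x => ?_, fun x hx => ?_⟩, ?_⟩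
  · exact Submodule.sum_mem _ fun s hs => hX _ _ (hSX hs)
  · exact closure_minimal (fun _ h => hgen h)
      (isClosed_eq P.toCLM.continuous continuous_id) (hdense hx)
  · rw [hP]
    exact Submodule.sum_mem _ fun s _ => theta_mem_moduleCompacts s s

theorem isFredholm_of_isClosed_range {T : AdjointableOp A E} (hT : IsClosed (Set.range T))
    (hker : orthonormalDim A (LinearMap.ker T.toLinearMap) < ⊤)
    (hker' : orthonormalDim A (LinearMap.ker T.adjoint.toLinearMap) < ⊤) : T.IsFredholm := by
  obtain ⟨P, hP, hPK⟩ := exists_isOrthogonalProjectionOnto T.smul_mem_ker hker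
  obtain ⟨Q, hQ, hQK⟩ := exists_isOrthogonalProjectionOnto T.adjoint.smul_mem_ker hker'
  obtain ⟨R, hRT, hTR⟩ := exists_map_map_eq_sub hP hQ hT
  refine ⟨⟨R, ?_⟩, ⟨R, ?_⟩⟩
  · have h : R.toCLM ∘L T.toCLM - ContinuousLinearMap.id ℂ E = -P.toCLM := by ext x; simp [hRT]
    exact h ▸ neg_mem hPK
  · have h : T.toCLM ∘L R.toCLM - ContinuousLinearMap.id ℂ E = -Q.toCLM := by ext y; simp [hTR]
    exact h ▸ neg_mem hQK

end HilbertModule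

theorem exists_finiteDimensional_norm_sub_starProjection_le {𝕜 V H : Type*} [RCLike 𝕜]
    [NormedAddCommGroup V] [NormedSpace 𝕜 V] [NormedAddCommGroup H] [InnerProductSpace 𝕜 H]
    {a : V →L[𝕜] H} (ha : IsCompactOperator a) {ε : ℝ} (hε : 0 < ε) :
    ∃ (W : Submodule 𝕜 H) (_ : FiniteDimensional 𝕜 W), ‖a - W.starProjection ∘L a‖ ≤ ε := by
  have htb : TotallyBounded (a '' Metric.closedBall 0 1) :=
    (ha.isCompact_closure_image_closedBall
      (f := (a : V →ₗ[𝕜] H)) 1).totallyBounded.subset subset_closure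
  obtain ⟨t, htf, htc⟩ := Metric.totallyBounded_iff.1 htb ε hε
  have hW : FiniteDimensional 𝕜 (Submodule.span 𝕜 t) := FiniteDimensional.span_of_finite 𝕜 htf
  refine ⟨Submodule.span 𝕜 t, hW, ?_⟩
  rw [← ContinuousLinearMap.sSup_unitClosedBall_eq_norm]
  refine Real.sSup_le (Set.forall_mem_image.2 fun x hx => ?_) hε.le
  obtain ⟨y, hy, hxy⟩ := Set.mem_iUnion₂.1 (htc ⟨x, hx, rfl⟩)
  calc ‖a x - (Submodule.span 𝕜 t).starProjection (a x)‖
      = ⨅ w : Submodule.span 𝕜 t, ‖a x - w‖ := Submodule.starProjection_minimal _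
    _ ≤ ‖a x - y‖ := ciInf_le ⟨0, Set.forall_mem_range.2 fun _ => norm_nonneg _⟩
      (⟨y, Submodule.subset_span hy⟩ : Submodule.span 𝕜 t)
    _ ≤ ε := (dist_eq_norm (a x) y ▸ Metric.mem_ball.1 hxy).le

section CompactAlgebra

variable {H : Type*} [NormedAddCommGroup H] [InnerProductSpace ℂ H] [CompleteSpace H]

namespace compactAlgebra

/-- The rank-one operator `ζ ↦ ⟪η, ζ⟫ ξ` as an element of `𝒦(H)`. -/
noncomputable def rankOne (ξ η : H) : compactAlgebra H :=
  ⟨InnerProductSpace.rankOne ℂ ξ η, by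
    have h := isCompactOperator_of_forall_mem (W := ℂ ∙ ξ) (InnerProductSpace.rankOne ℂ ξ η)
      fun z => Submodule.mem_span_singleton.2 ⟨_, rfl⟩
    exact h⟩

@[simp]
theorem coe_rankOne (ξ η : H) :
    (rankOne ξ η : H →L[ℂ] H) = InnerProductSpace.rankOne ℂ ξ η := rfl

theorem rankOne_mul (ξ η : H) (a : compactAlgebra H) :
    rankOne ξ η * a = rankOne ξ ((star a : compactAlgebra H).1 η) :=
  Subtype.ext <| ContinuousLinearMap.ext fun z => by
    simp [ContinuousLinearMap.star_eq_adjoint, ContinuousLinearMap.adjoint_inner_left]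

theorem rankOne_mul_mul_rankOne (ξ η ζ θ : H) (a : compactAlgebra H) :
    rankOne ξ η * a * rankOne ζ θ = ⟪η, (a : H →L[ℂ] H) ζ⟫_ℂ • rankOne ξ θ :=
  Subtype.ext <| ContinuousLinearMap.ext fun z => by simp [smul_smul, mul_comm]

theorem rankOne_mul_rankOne (ξ η ζ θ : H) :
    rankOne ξ η * rankOne ζ θ = ⟪η, ζ⟫_ℂ • rankOne ξ θ :=
  Subtype.ext <| ContinuousLinearMap.ext fun z => by simp [smul_smul, mul_comm]

theorem star_rankOne (ξ η : H) : star (rankOne ξ η) = rankOne η ξ :=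
  Subtype.ext (InnerProductSpace.adjoint_rankOne ξ η)

theorem norm_rankOne (ξ η : H) : ‖rankOne ξ η‖ = ‖ξ‖ * ‖η‖ :=
  InnerProductSpace.norm_rankOne ξ η

theorem rankOne_mul_rankOne_of_norm_eq_one {η : H} (hη : ‖η‖ = 1) (ξ ζ : H) :
    rankOne ξ η * rankOne η ζ = rankOne ξ ζ := by
  rw [rankOne_mul_rankOne, inner_self_eq_one_of_norm_eq_one hη, one_smul]

theorem isMinimalProjection_rankOne {ξ : H} (hξ : ‖ξ‖ = 1) :
    IsMinimalProjection (rankOne ξ ξ) := by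
  refine ⟨⟨rankOne_mul_rankOne_of_norm_eq_one hξ ξ ξ, star_rankOne ξ ξ⟩, ?_,
    fun a => ⟨_, rankOne_mul_mul_rankOne ξ ξ ξ ξ a⟩⟩
  rw [← norm_ne_zero_iff, norm_rankOne, hξ, mul_one]
  exact one_ne_zero

theorem exists_mem_span_rankOne_norm_sub_mul_le (a : compactAlgebra H) {ε : ℝ} (hε : 0 < ε) :
    ∃ f ∈ Submodule.span ℂ (Set.range fun η : H => rankOne η η),
      IsSelfAdjoint f ∧ ‖f‖ ≤ 1 ∧ ‖a - f * a‖ ≤ ε := by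
  obtain ⟨W, _, hW⟩ := exists_finiteDimensional_norm_sub_starProjection_le a.2 hε
  let b := stdOrthonormalBasis ℂ W
  let f : compactAlgebra H := ∑ i, rankOne (b i : H) (b i : H)
  have hf : (f : H →L[ℂ] H) = W.starProjection := by
    simp [f, b.starProjection_eq_sum_rankOne]
  refine ⟨f, Submodule.sum_mem _ fun i _ => Submodule.subset_span ⟨_, rfl⟩, ?_, ?_, ?_⟩
  · simp [f, IsSelfAdjoint, star_rankOne]
  · exact (congrArg norm hf).trans_le W.starProjection_norm_le
  · rw [← hf] at hW
    exact hW

end compactAlgebra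

end CompactAlgebra

section CompactModule

open compactAlgebra

variable {H : Type*} [NormedAddCommGroup H] [InnerProductSpace ℂ H] [CompleteSpace H]
  {E : Type*} [NormedAddCommGroup E] [NormedSpace ℂ E]
  [SMul (compactAlgebra H) E] [CStarModule (compactAlgebra H) E]

theorem mem_of_forall_rankOne_smul_mem {X : Submodule ℂ E} (hX : IsClosed (X : Set E)) {x : E}
    (h : ∀ η : H, rankOne η η • x ∈ X) : x ∈ X := by
  refine hX.closure_subset_iff.2 subset_rfl (Metric.mem_closure_iff.2 fun ε hε => ?_)
  obtain ⟨f, hf, hfsa, hf1, hle⟩ := exists_mem_span_rankOne_norm_sub_mul_le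
    (inner (compactAlgebra H) x x) (ε := ε ^ 2 / 4) (by positivity)
  have hspan : Submodule.span ℂ (Set.range fun η : H => rankOne η η) ≤
      X.comap ((moduleSMulL (compactAlgebra H) E).flip x).toLinearMap :=
    Submodule.span_le.2 (Set.range_subset_iff.2 h)
  refine ⟨f • x, hspan hf, lt_of_pow_lt_pow_left₀ 2 hε.le ?_⟩
  rw [dist_eq_norm]
  nlinarith [norm_sub_smul_sq_le hfsa hf1 x]

theorem norm_le_of_forall_norm_rankOne_smul_le {ξ : H} (hξ : ‖ξ‖ = 1) {x : E} {M : ℝ}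
    (h : ∀ η : H, ‖rankOne ξ η • x‖ ≤ M * ‖η‖) : ‖x‖ ≤ M := by
  have hM : 0 ≤ M := by simpa [hξ] using (norm_nonneg _).trans (h ξ)
  rcases (norm_nonneg x).eq_or_lt with hx | hx
  · rwa [← hx]
  set a := inner (compactAlgebra H) x x
  have hinner : ∀ η, inner (compactAlgebra H) x (rankOne ξ η • x) =
      rankOne ξ ((a : H →L[ℂ] H) η) := fun η => by
    rw [CStarModule.inner_op_smul_right, rankOne_mul, CStarModule.star_inner]
  have happly : ∀ η, ‖(a : H →L[ℂ] H) η‖ ≤ ‖x‖ * M * ‖η‖ := fun η =>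
    calc ‖(a : H →L[ℂ] H) η‖ = ‖inner (compactAlgebra H) x (rankOne ξ η • x)‖ := by
          rw [hinner, norm_rankOne, hξ, one_mul]
      _ ≤ ‖x‖ * ‖rankOne ξ η • x‖ := CStarModule.norm_inner_le E
      _ ≤ ‖x‖ * M * ‖η‖ := by rw [mul_assoc]; gcongr; exact h η
  have hnorm : ‖a‖ ≤ ‖x‖ * M :=
    ContinuousLinearMap.opNorm_le_bound _ (mul_nonneg hx.le hM) happly
  refine le_of_mul_le_mul_left ?_ hx
  rwa [← sq, CStarModule.norm_sq_eq (compactAlgebra H)]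

variable (H E) in
theorem subsingleton_or_nonempty_sphere : Subsingleton E ∨ Nonempty (Metric.sphere (0 : H) 1) := by
  rcases subsingleton_or_nontrivial H with _ | _
  · exact .inl <| subsingleton_of_forall_eq 0 fun x =>
      (CStarModule.inner_self (A := compactAlgebra H)).1 <|
        Subtype.ext <| ContinuousLinearMap.ext fun _ => Subsingleton.elim _ _
  · exact .inr (NormedSpace.sphere_nonempty.2 zero_le_one).to_subtype

variable (E) in
/-- The corner `e E` of a Hilbert `𝒦(H)`-module, where `e` is the minimal projection onto the line
spanned by the unit vector `ξ`. It is a Hilbert space, its inner product being `c` where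
`⟪x, y⟫ = c • e`. -/
noncomputable def corner (ξ : Metric.sphere (0 : H) 1) : Submodule ℂ E :=
  LinearMap.eqLocus (moduleSMulL (compactAlgebra H) E (rankOne ξ ξ)).toLinearMap LinearMap.id

variable {ξ : Metric.sphere (0 : H) 1}

theorem mem_corner {x : E} : x ∈ corner E ξ ↔ rankOne (ξ : H) ξ • x = x := Iff.rfl

theorem isClosed_corner : IsClosed (corner E ξ : Set E) :=
  isClosed_eq (moduleSMulL (compactAlgebra H) E (rankOne ξ ξ)).continuous continuous_id

theorem rankOne_smul_mem_corner (η : H) (x : E) : rankOne (ξ : H) η • x ∈ corner E ξ := by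
  rw [mem_corner, ← mul_smul_cstar, rankOne_mul_rankOne_of_norm_eq_one (norm_eq_of_mem_sphere ξ)]

variable (ξ) in
theorem rankOne_smul_rankOne_smul (η : H) (x : E) :
    rankOne η ξ • rankOne (ξ : H) η • x = rankOne η η • x := by
  rw [← mul_smul_cstar, rankOne_mul_rankOne_of_norm_eq_one (norm_eq_of_mem_sphere ξ)]

theorem AdjointableOp.map_mem_corner (T : AdjointableOp (compactAlgebra H) E) {x : E}
    (hx : x ∈ corner E ξ) : T x ∈ corner E ξ := by
  rw [mem_corner, ← T.map_smul, mem_corner.1 hx]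

theorem inner_eq_smul_rankOne {x y : E} (hx : x ∈ corner E ξ) (hy : y ∈ corner E ξ) :
    inner (compactAlgebra H) x y =
      ⟪(ξ : H), (inner (compactAlgebra H) x y : H →L[ℂ] H) ξ⟫_ℂ • rankOne (ξ : H) ξ := by
  rw [← rankOne_mul_mul_rankOne]
  conv_lhs => rw [← mem_corner.1 hx, ← mem_corner.1 hy, CStarModule.inner_op_smul_left,
    CStarModule.inner_op_smul_right, star_rankOne]

noncomputable instance : InnerProductSpace ℂ (corner E ξ) where
  inner x y := ⟪(ξ : H), (inner (compactAlgebra H) (x : E) (y : E) : H →L[ℂ] H) ξ⟫_ℂ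
  norm_sq_eq_re_inner x := by
    have hpos : (inner (compactAlgebra H) (x : E) (x : E) : H →L[ℂ] H).IsPositive :=
      (ContinuousLinearMap.nonneg_iff_isPositive _).1
        (CStarModule.inner_self_nonneg (A := compactAlgebra H) (x := (x : E)))
    calc ‖(x : E)‖ ^ 2 = ‖inner (compactAlgebra H) (x : E) (x : E)‖ :=
          CStarModule.norm_sq_eq (compactAlgebra H)
      _ = ‖⟪(ξ : H), (inner (compactAlgebra H) (x : E) (x : E) : H →L[ℂ] H) ξ⟫_ℂ‖ :=
          (congrArg norm (inner_eq_smul_rankOne x.2 x.2)).trans (by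
            rw [norm_smul, norm_rankOne, norm_eq_of_mem_sphere, one_mul, mul_one])
      _ = _ := (Complex.re_eq_norm.2 (hpos.inner_nonneg_right ξ)).symm
  conj_inner_symm x y := by
    rw [inner_conj_symm, ← CStarModule.star_inner (y : E) (x : E)]
    exact (ContinuousLinearMap.adjoint_inner_right
      (inner (compactAlgebra H) (y : E) (x : E) : H →L[ℂ] H) ξ ξ).symm
  add_left x y z := by simp
  smul_left x y c := by simp

theorem isOrthonormalSystem_range_of_orthonormal {ι : Type*} {v : ι → corner E ξ}
    (hv : Orthonormal ℂ v) :
    IsOrthonormalSystem (compactAlgebra H) (Set.range fun i => (v i : E)) := by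
  have hinner : ∀ i j, inner (compactAlgebra H) (v i : E) (v j : E) =
      ⟪v i, v j⟫_ℂ • rankOne (ξ : H) ξ := fun i j => inner_eq_smul_rankOne (v i).2 (v j).2
  refine ⟨?_, ?_⟩
  · rintro _ ⟨i, rfl⟩
    rw [hinner, inner_self_eq_one_of_norm_eq_one (hv.1 i), one_smul]
    exact isMinimalProjection_rankOne (norm_eq_of_mem_sphere ξ)
  · rintro _ ⟨i, rfl⟩ _ ⟨j, rfl⟩ hij
    rw [hinner, hv.2 (ne_of_apply_ne (fun i => (v i : E)) hij), zero_smul]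

variable (ξ) in
theorem orthonormalDim_lt_top_of_finiteDimensional_submoduleOf {X : Submodule ℂ E}
    (hX : ∀ a : compactAlgebra H, ∀ x ∈ X, a • x ∈ X)
    [FiniteDimensional ℂ (X.submoduleOf (corner E ξ))] :
    orthonormalDim (compactAlgebra H) X < ⊤ := by
  let b := stdOrthonormalBasis ℂ (X.submoduleOf (corner E ξ))
  let v : _ → corner E ξ := fun i => b i
  have hv : Orthonormal ℂ v := b.orthonormal.comp_linearIsometry (Submodule.subtypeₗᵢ _)
  let S : Set E := Set.range fun i => (v i : E)
  have hspan : ∀ x ∈ X, ∀ η : H, rankOne (ξ : H) η • x ∈ Submodule.span ℂ S := by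
    intro x hx η
    let w : X.submoduleOf (corner E ξ) :=
      ⟨⟨rankOne (ξ : H) η • x, rankOne_smul_mem_corner η x⟩, hX _ _ hx⟩
    have hw : rankOne (ξ : H) η • x = ∑ i, b.repr w i • (v i : E) := by
      simpa [v] using congrArg (fun u : X.submoduleOf (corner E ξ) => ((u : corner E ξ) : E))
        (b.sum_repr w).symm
    rw [hw]
    exact Submodule.sum_mem _ fun i _ => Submodule.smul_mem _ _ (Submodule.subset_span ⟨i, rfl⟩)
  have hbasis : IsOrthonormalBasisOf (compactAlgebra H) X S := by
    refine ⟨Set.range_subset_iff.2 fun i => (b i).2,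
      isOrthonormalSystem_range_of_orthonormal hv, fun x hx => ?_⟩
    refine mem_of_forall_rankOne_smul_mem
      (generatedSubmodule (compactAlgebra H) S).isClosed_topologicalClosure fun η : H => ?_
    rw [← rankOne_smul_rankOne_smul ξ η x]
    exact Submodule.le_topologicalClosure _ (smul_mem_generatedSubmodule _ (hspan x hx η))
  exact (iInf₂_le S hbasis).trans_lt (Set.finite_range _).encard_lt_top

theorem inner_mul_rankOne {z : E} (hz : z ∈ corner E ξ) (x : E) (η ζ : H) :
    inner (compactAlgebra H) x z * rankOne η ζ =
      ⟪(ξ : H), (inner (compactAlgebra H) x z : H →L[ℂ] H) η⟫_ℂ • rankOne (ξ : H) ζ := by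
  rw [← rankOne_mul_mul_rankOne, ← CStarModule.inner_op_smul_right, mem_corner.1 hz]

variable [CompleteSpace E]

theorem isCompactOperator_theta_comp_subtypeL (x y : E) :
    IsCompactOperator ((AdjointableOp.theta (A := compactAlgebra H) x y).toCLM ∘L
      (corner E ξ).subtypeL) := by
  let Θ : E →L[ℂ] corner E ξ →L[ℂ] E :=
    (ContinuousLinearMap.compL ℂ (corner E ξ) (compactAlgebra H) E).flip
      (CStarModule.innerSL (A := compactAlgebra H) x ∘L (corner E ξ).subtypeL) ∘L
        (moduleSMulL (compactAlgebra H) E).flip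
  let X : Submodule ℂ E := (compactOperator (RingHom.id ℂ) (corner E ξ) E).comap Θ.toLinearMap
  have hX : IsClosed (X : Set E) :=
    isClosed_setOfPred_isCompactOperator.preimage Θ.continuous
  refine mem_of_forall_rankOne_smul_mem (X := X) hX fun η : H => ?_
  refine isCompactOperator_of_forall_mem (W := ℂ ∙ (rankOne (ξ : H) η • y)) _ fun z => ?_
  refine Submodule.mem_span_singleton.2
    ⟨⟪(ξ : H), (inner (compactAlgebra H) x (z : E) : H →L[ℂ] H) η⟫_ℂ, ?_⟩
  calc ⟪(ξ : H), (inner (compactAlgebra H) x (z : E) : H →L[ℂ] H) η⟫_ℂ • rankOne (ξ : H) η • y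
      = (inner (compactAlgebra H) x (z : E) * rankOne η η) • y := by
        rw [inner_mul_rankOne z.2]
        exact ((moduleSMulL (compactAlgebra H) E).map_smul₂ _ _ _).symm
    _ = inner (compactAlgebra H) x (z : E) • rankOne η η • y := mul_smul_cstar _ _ _

theorem isCompactOperator_comp_subtypeL_of_mem_moduleCompacts {k : E →L[ℂ] E}
    (hk : k ∈ moduleCompacts (compactAlgebra H) E) :
    IsCompactOperator (k ∘L (corner E ξ).subtypeL) := by
  let V : Submodule ℂ (E →L[ℂ] E) := (compactOperator (RingHom.id ℂ) (corner E ξ) E).comap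
    (ContinuousLinearMap.precomp E (corner E ξ).subtypeL).toLinearMap
  have hV : IsClosed (V : Set (E →L[ℂ] E)) :=
    isClosed_setOfPred_isCompactOperator.preimage
      (ContinuousLinearMap.precomp E (corner E ξ).subtypeL).continuous
  exact moduleCompacts_le hV isCompactOperator_theta_comp_subtypeL hk

theorem orthonormalDim_lt_top_of_norm_le {X : Submodule ℂ E} (hXc : IsClosed (X : Set E))
    (hX : ∀ a : compactAlgebra H, ∀ x ∈ X, a • x ∈ X) {k : E →L[ℂ] E}
    (hk : k ∈ moduleCompacts (compactAlgebra H) E) (hle : ∀ x ∈ X, ‖x‖ ≤ ‖k x‖) :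
    orthonormalDim (compactAlgebra H) X < ⊤ := by
  rcases subsingleton_or_nonempty_sphere H E with _ | ⟨⟨ξ⟩⟩
  · exact orthonormalDim_lt_top_of_subsingleton X
  have : CompleteSpace (corner E ξ) := isClosed_corner.completeSpace_coe
  have : CompleteSpace (X.submoduleOf (corner E ξ)) :=
    (hXc.preimage continuous_subtype_val).completeSpace_coe
  have : FiniteDimensional ℂ (X.submoduleOf (corner E ξ)) :=
    finiteDimensional_of_norm_le_compact
      (k := (k ∘L (corner E ξ).subtypeL) ∘L (X.submoduleOf (corner E ξ)).subtypeL)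
      ((isCompactOperator_comp_subtypeL_of_mem_moduleCompacts hk).comp_clm _) fun x => hle _ x.2
  exact orthonormalDim_lt_top_of_finiteDimensional_submoduleOf ξ hX


variable {T S : AdjointableOp (compactAlgebra H) E}

theorem orthonormalDim_ker_lt_top
    (hST : S.toCLM ∘L T.toCLM - ContinuousLinearMap.id ℂ E ∈ moduleCompacts (compactAlgebra H) E) :
    orthonormalDim (compactAlgebra H) (LinearMap.ker T.toLinearMap) < ⊤ := by
  refine orthonormalDim_lt_top_of_norm_le T.toCLM.isClosed_ker T.smul_mem_ker hST fun x hx => ?_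
  have hTx : T x = 0 := hx
  simp [hTx]

theorem orthonormalDim_ker_adjoint_lt_top
    (hTS : T.toCLM ∘L S.toCLM - ContinuousLinearMap.id ℂ E ∈ moduleCompacts (compactAlgebra H) E) :
    orthonormalDim (compactAlgebra H) (LinearMap.ker T.adjoint.toLinearMap) < ⊤ := by
  refine orthonormalDim_lt_top_of_norm_le T.adjoint.toCLM.isClosed_ker T.adjoint.smul_mem_ker hTS
    fun x hx => ?_
  have hx : T.adjoint x = 0 := hx
  have horth : inner (compactAlgebra H) (-x) (T (S x)) = 0 := by
    rw [CStarModule.inner_neg_left, ← T.isAdjointPair.symm, hx, CStarModule.inner_zero_left,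
      neg_zero]
  calc ‖x‖ = ‖-x‖ := (norm_neg x).symm
    _ ≤ ‖-x + T (S x)‖ := norm_le_norm_add_of_inner_eq_zero horth
    _ = ‖(T.toCLM ∘L S.toCLM - ContinuousLinearMap.id ℂ E) x‖ := by simp [neg_add_eq_sub]

theorem exists_norm_sub_le (ξ : Metric.sphere (0 : H) 1)
    (hST : S.toCLM ∘L T.toCLM - ContinuousLinearMap.id ℂ E ∈ moduleCompacts (compactAlgebra H) E)
    {P : AdjointableOp (compactAlgebra H) E}
    (hP : IsOrthogonalProjectionOnto P (LinearMap.ker T.toLinearMap)) :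
    ∃ C : ℝ, 0 ≤ C ∧ ∀ x ∈ corner E ξ, ‖x - P x‖ ≤ C * ‖T x‖ := by
  let V : Submodule ℂ (corner E ξ) := P.toCLM.ker.submoduleOf (corner E ξ)
  have : CompleteSpace (corner E ξ) := isClosed_corner.completeSpace_coe
  have : CompleteSpace V :=
    (P.toCLM.isClosed_ker.preimage continuous_subtype_val).completeSpace_coe
  let ι : V →L[ℂ] E := (corner E ξ).subtypeL ∘L V.subtypeL
  have hPι : ∀ v : V, P (ι v) = 0 := fun v => v.2
  have hinj : Function.Injective (T.toCLM ∘L ι) :=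
    (injective_iff_map_eq_zero _).2 fun v hv =>
      Subtype.ext <| Subtype.ext <| (hP.map_eq_self _ hv).symm.trans (hPι v)
  set k := S.toCLM ∘L T.toCLM - ContinuousLinearMap.id ℂ E with hk
  have hle : ∀ v : V, ‖v‖ ≤ ‖S.toCLM‖ * ‖(T.toCLM ∘L ι) v‖ + ‖(k ∘L ι) v‖ := fun v =>
    calc ‖ι v‖ = ‖S.toCLM (T.toCLM (ι v)) - k (ι v)‖ := by simp [hk]
      _ ≤ ‖S.toCLM (T.toCLM (ι v))‖ + ‖k (ι v)‖ := norm_sub_le _ _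
      _ ≤ ‖S.toCLM‖ * ‖T.toCLM (ι v)‖ + ‖k (ι v)‖ := by gcongr; exact S.toCLM.le_opNorm _
  obtain ⟨C, hC0, hC⟩ := exists_norm_le_of_norm_le_add_compact hinj
    ((isCompactOperator_comp_subtypeL_of_mem_moduleCompacts hST).comp_clm V.subtypeL) hle
  refine ⟨C, hC0, fun x hx => ?_⟩
  have hTP : T (P x) = 0 := hP.map_mem x
  have hker : P (x - P x) = 0 := by rw [P.map_sub, hP.map_eq_self _ (hP.map_mem x), sub_self]
  calc ‖x - P x‖ ≤ C * ‖T.toCLM (x - P x)‖ :=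
        hC ⟨⟨x - P x, sub_mem hx (P.map_mem_corner hx)⟩, hker⟩
    _ = C * ‖T x‖ := by simp [hTP]

theorem isClosed_range_of_parametrix
    (hST : S.toCLM ∘L T.toCLM - ContinuousLinearMap.id ℂ E ∈ moduleCompacts (compactAlgebra H) E) :
    IsClosed (Set.range T) := by
  rcases subsingleton_or_nonempty_sphere H E with _ | ⟨⟨ξ⟩⟩
  · exact Set.subsingleton_of_subsingleton.isClosed
  obtain ⟨P, hP, -⟩ := exists_isOrthogonalProjectionOnto (A := compactAlgebra H) T.smul_mem_ker
    (orthonormalDim_ker_lt_top hST)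
  obtain ⟨C, hC0, hC⟩ := exists_norm_sub_le ξ hST hP
  refine (isClosed_range_iff_exists_norm_sub_le (f := T.toCLM) (p := P.toCLM)
    hP.map_mem hP.map_eq_self).2 ⟨C, hC0, fun x => ?_⟩
  refine norm_le_of_forall_norm_rankOne_smul_le (norm_eq_of_mem_sphere ξ) fun η => ?_
  calc ‖rankOne (ξ : H) η • (x - P x)‖
      = ‖rankOne (ξ : H) η • x - P (rankOne (ξ : H) η • x)‖ := by
        rw [P.map_smul, ← moduleSMulL_apply, map_sub, moduleSMulL_apply, moduleSMulL_apply]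
    _ ≤ C * ‖rankOne (ξ : H) η • T x‖ := T.map_smul _ x ▸ hC _ (rankOne_smul_mem_corner η x)
    _ ≤ C * (‖η‖ * ‖T x‖) := by
        gcongr
        simpa [norm_rankOne] using norm_smul_le_cstar (rankOne (ξ : H) η) (T x)
    _ = C * ‖T x‖ * ‖η‖ := by ring

end CompactModule

theorem theorem3p7 {H : Type*} [NormedAddCommGroup H] [InnerProductSpace ℂ H] [CompleteSpace H]
    {E : Type*} [NormedAddCommGroup E] [NormedSpace ℂ E] [CompleteSpace E]
    [SMul (compactAlgebra H) E] [CStarModule (compactAlgebra H) E]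
    (T : AdjointableOp (compactAlgebra H) E) :
    T.IsFredholm ↔
      IsClosed (Set.range T) ∧
      orthonormalDim (compactAlgebra H) (LinearMap.ker T.toLinearMap) < ⊤ ∧
      orthonormalDim (compactAlgebra H) (LinearMap.ker T.adjoint.toLinearMap) < ⊤ := by
  constructor
  · rintro ⟨⟨S, hST⟩, ⟨S', hTS'⟩⟩
    exact ⟨isClosed_range_of_parametrix hST, orthonormalDim_ker_lt_top hST,
      orthonormalDim_ker_adjoint_lt_top hTS'⟩
  · rintro ⟨hT, hker, hker'⟩
    exact isFredholm_of_isClosed_range hT hker hker'
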